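/- Let $n\ge 3$ be an odd integer. For $M\in M_n(\mathbb C)$ write $M=A+S$ with $A=\frac12(M-M^t)$ skew-symmetric and $S=\frac12(M+M^t)$ symmetric, and put $$P_\Lambda(M)=\det(A,\ldots,A,S),$$ where $\det(M_1,\ldots,M_n)$ denotes the complete polarization of the determinant, i.e. the symmetric $n$-linear form on $M_n(\mathbb C)$ with $\det(M,\ldots,M)=\det M$. Then $P_\Lambda$ is a homogeneous polynomial of degree $n$ in the entries of $M$; let $Z(P_\Lambda)\subset\mathbb P(M_n(\mathbb C))$ be the (reduced) hypersurface that it defines, and let its dual variety $Z(P_\Lambda)^*\subset\mathbb P(M_n(\mathbb C)^*)$ be the Zariski closure of the set of hyperplanes tangent to $Z(P_\Lambda)$ at its smooth points. Identify $S^2\mathbb C^n\oplus\Lambda^2\mathbb C^n$ with $\mathbb C^n\otimes\mathbb C^n=M_n(\mathbb C)$ by $v^2=v\otimes v$ and $v\wedge w=v\otimes w-w\otimes v$. Then $Z(P_\Lambda)^*$ is isomorphic, as a projective variety, to the Zariski closure of $$\mathbb P\{v^2\oplus v\wedge w : v,w\in\mathbb C^n\}\subset\mathbb P(S^2\mathbb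 C^n\oplus\Lambda^2\mathbb C^n)=\mathbb P(M_n(\mathbb C)).$$ -/

import Mathlib

open scoped LinearAlgebra.Projectivization

noncomputable section

namespace DualLambda

/-! ### Projective algebraic sets over the complex numbers

The projective space `ℙ(ℂ^σ)` is `ℙ ℂ (σ → ℂ)`, with homogeneous coordinates indexed by `σ`. -/

/-- A subset of projective space is Zariski closed if it is the common zero locus of a set of
homogeneous polynomials. -/
def IsZariskiClosed {σ : Type} (X : Set (ℙ ℂ (σ → ℂ))) : Prop :=
  ∃ F : Set (MvPolynomial σ ℂ), (∀ p ∈ F, ∃ d : ℕ, p.IsHomogeneous d) ∧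
    X = {x | ∀ p ∈ F, MvPolynomial.eval x.rep p = 0}

/-- The Zariski closure of a subset of projective space: the smallest Zariski closed set
containing it. -/
def zariskiClosure {σ : Type} (X : Set (ℙ ℂ (σ → ℂ))) : Set (ℙ ℂ (σ → ℂ)) :=
  ⋂₀ {Y | IsZariskiClosed Y ∧ X ⊆ Y}

/-- A map between projective algebraic sets is regular (a morphism of varieties) if around every
point `x` it is given by homogeneous polynomials `F j` of one common degree: they do not all
vanish at `x`, and `f y = [F j (y)]_j` at every point `y` of `X` where they do not all vanish.
(If `f` agrees with `[F j]_j` only on a smaller neighbourhood `{g ≠ 0}` of `x`, with `g`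
homogeneous, replace each `F j` by `g * F j`.) -/
def IsRegularMap {σ τ : Type} {X : Set (ℙ ℂ (σ → ℂ))} {Y : Set (ℙ ℂ (τ → ℂ))}
    (f : X → Y) : Prop :=
  ∀ x : X, ∃ (d : ℕ) (F : τ → MvPolynomial σ ℂ),
    (∀ j, (F j).IsHomogeneous d) ∧
    (fun j => MvPolynomial.eval x.1.rep (F j)) ≠ 0 ∧
    ∀ (y : X) (hy : (fun j => MvPolynomial.eval y.1.rep (F j)) ≠ 0),
      (f y).1 = Projectivization.mk ℂ (fun j => MvPolynomial.eval y.1.rep (F j)) hy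

/-- Isomorphism of projective algebraic sets: a bijection that is regular in both directions. -/
def AreIsomorphic {σ τ : Type} (X : Set (ℙ ℂ (σ → ℂ))) (Y : Set (ℙ ℂ (τ → ℂ))) : Prop :=
  ∃ e : X ≃ Y, IsRegularMap (e : X → Y) ∧ IsRegularMap (e.symm : Y → X)

/-! ### Dual varieties of hypersurfaces -/

/-- The affine cone over the hypersurface `Z(P)`. -/
def affineCone {σ : Type} (P : MvPolynomial σ ℂ) : Set (σ → ℂ) :=
  {x | MvPolynomial.eval x P = 0}

/-- The (embedded) tangent space at `x` of the affine cone over `Z(P)`, as a reduced variety: the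
common kernel of the differentials at `x` of all polynomials that vanish on the cone. -/
def coneTangentSpace {σ : Type} [Fintype σ] (P : MvPolynomial σ ℂ) (x : σ → ℂ) : Set (σ → ℂ) :=
  {y | ∀ f ∈ MvPolynomial.vanishingIdeal ℂ (affineCone P),
    ∑ i, MvPolynomial.eval x (MvPolynomial.pderiv i f) * y i = 0}

/-- The set of tangent hyperplanes to the hypersurface `Z(P)` defined by a homogeneous polynomial
`P`. A point `ξ` of the dual projective space, in dual coordinates, stands for the hyperplane
`∑ i, ξ i * y i = 0`. It is tangent to `Z(P)` at a point `[x]` of `Z(P)` if it is equal to the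
tangent space there; as that tangent space is then a hyperplane, `[x]` is a smooth point of the
(reduced) hypersurface. -/
def tangentHyperplanes {σ : Type} [Fintype σ] (P : MvPolynomial σ ℂ) : Set (ℙ ℂ (σ → ℂ)) :=
  {ξ | ∃ x : σ → ℂ, x ≠ 0 ∧ x ∈ affineCone P ∧
    {y : σ → ℂ | ∑ i, ξ.rep i * y i = 0} = coneTangentSpace P x}

/-- The dual variety `Z(P)^*`: the Zariski closure of the set of tangent hyperplanes. -/
def dualVariety {σ : Type} [Fintype σ] (P : MvPolynomial σ ℂ) : Set (ℙ ℂ (σ → ℂ)) :=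
  zariskiClosure (tangentHyperplanes P)

/-! ### The polynomial `P_Λ` -/

/-- The complete polarization of the determinant: the symmetric multilinear form
`det(M_1, …, M_n)` in `n` matrices of size `n` with `det(M, …, M) = det M`. It is the average,
over all the ways to assign the `n` matrices to the `n` rows, of the determinant whose `i`-th row
is the `i`-th row of the matrix assigned to `i`. -/
def polarizedDet {n : ℕ} {R : Type} [CommRing R] [Algebra ℂ R]
    (M : Fin n → Matrix (Fin n) (Fin n) R) : R :=
  ((n.factorial : ℂ)⁻¹) •
    ∑ π : Equiv.Perm (Fin n), Matrix.det (Matrix.of fun i j => M (π i) i j)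

/-- The symmetric part `S` of the generic `n × n` matrix. -/
def genericSymmPart (n : ℕ) : Matrix (Fin n) (Fin n) (MvPolynomial (Fin n × Fin n) ℂ) :=
  (2⁻¹ : ℂ) • (Matrix.mvPolynomialX (Fin n) (Fin n) ℂ +
    (Matrix.mvPolynomialX (Fin n) (Fin n) ℂ).transpose)

/-- The skew-symmetric part `A` of the generic `n × n` matrix. -/
def genericSkewPart (n : ℕ) : Matrix (Fin n) (Fin n) (MvPolynomial (Fin n × Fin n) ℂ) :=
  (2⁻¹ : ℂ) • (Matrix.mvPolynomialX (Fin n) (Fin n) ℂ -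
    (Matrix.mvPolynomialX (Fin n) (Fin n) ℂ).transpose)

/-- `P_Λ(M) = det(A, …, A, S)`, where `M = A + S` is the decomposition of an `n × n` matrix into
its skew-symmetric part `A` and its symmetric part `S`; a polynomial in the entries of `M`. -/
def PLambda (n : ℕ) : MvPolynomial (Fin n × Fin n) ℂ :=
  polarizedDet fun k : Fin n => if (k : ℕ) + 1 = n then genericSymmPart n else genericSkewPart n

/-! ### The variety of the points `[v² ⊕ v ∧ w]` -/

/-- The coordinates of `v² ⊕ v ∧ w` in `S²ℂⁿ ⊕ Λ²ℂⁿ = ℂⁿ ⊗ ℂⁿ = M_n(ℂ)`, with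
`v² = v ⊗ v` and `v ∧ w = v ⊗ w - w ⊗ v`. -/
def squareAddWedge {n : ℕ} (v w : Fin n → ℂ) : Fin n × Fin n → ℂ :=
  fun p => v p.1 * v p.2 + (v p.1 * w p.2 - w p.1 * v p.2)

/-- The subset `ℙ{v² ⊕ v ∧ w : v, w ∈ ℂⁿ}` of `ℙ(S²ℂⁿ ⊕ Λ²ℂⁿ) = ℙ(M_n(ℂ))`. -/
def squareWedgePoints (n : ℕ) : Set (ℙ ℂ (Fin n × Fin n → ℂ)) :=
  {x | ∃ (v w : Fin n → ℂ) (h : squareAddWedge v w ≠ 0),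
    x = Projectivization.mk ℂ (squareAddWedge v w) h}

end DualLambda

end

/-!
The two varieties are equal once the dual space of `M_n(ℂ)` is given the dual coordinates, so the
isomorphism is the identity.

Expanding the polarization gives `n P_Λ(A + S) = tr (adj A * S)`. As `n` is odd, a skew-symmetric
`A` is singular. If its kernel is a line, spanned by `v`, then `adj A = c v vᵀ` with `c ≠ 0`, and
the image of `A` is the orthogonal complement of `v`. So `A + S` lies on the hypersurface if and
only if `vᵀ S v = 0`, that is, if and only if `S v = A u` for some `u`. Differentiating
`A * adj A = adj A * A = 0` shows that the differential of `P_Λ` at such a point is a nonzero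
multiple of `M ↦ vᵀ M v - 2 vᵀ A(M) u`, which in coordinates is `v² ⊕ v ∧ (-u)`
(`exists_dirDeriv_PLambda_eq`). Since `P_Λ` is linear in `S`, the hypersurface is locally a graph
there, and so the tangent space of the reduced hypersurface is the kernel of this differential
(`coneTangentSpace_eq`). Every nonzero `v` spans the kernel of some skew-symmetric matrix
(`exists_skew_kernelIsLine`), and `u` is arbitrary, so that every point `[v² ⊕ v ∧ w]` is a tangent
hyperplane (`squareWedgePoints_subset_tangentHyperplanes`).

Conversely, a tangent hyperplane at a point where `A` has a larger kernel is the differential there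
of some polynomial `f` that vanishes on the hypersurface. Let `k` be an isotropic vector of `S` in
the kernel of `A`, and let `B` be skew-symmetric with kernel spanned by `k`. The line `A + t B + S`
lies in the hypersurface, and for almost all `t` the kernel of `A + t B` is a line. There the
differential of `f` is a multiple of some `v² ⊕ v ∧ w`, so that homogeneous equations of the set of
points `[v² ⊕ v ∧ w]` hold for it, and by continuity they hold at `t = 0`
(`eval_gradient_eq_zero`). No irreducibility of `P_Λ` is needed.
-/

namespace DualLambda

open Matrix

/-! ### Square matrices whose kernel is a line -/

section LinearAlgebra

variable {ι : Type*} [Fintype ι]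

/-- The kernel of the matrix `A` is the line spanned by the nonzero vector `v`. -/
structure KernelIsLine (A : Matrix ι ι ℂ) (v : ι → ℂ) : Prop where
  ne_zero : v ≠ 0
  mulVec_eq_zero : A *ᵥ v = 0
  exists_smul : ∀ x, A *ᵥ x = 0 → ∃ c : ℂ, x = c • v

theorem vecMul_eq_neg_mulVec {A : Matrix ι ι ℂ} (hA : Aᵀ = -A) (x : ι → ℂ) :
    x ᵥ* A = -(A *ᵥ x) := by
  rw [← mulVec_transpose, hA, neg_mulVec]

theorem dotProduct_mulVec_eq_zero_of_skew {A : Matrix ι ι ℂ} (hA : Aᵀ = -A) {v : ι → ℂ}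
    (hv : A *ᵥ v = 0) (x : ι → ℂ) : v ⬝ᵥ A *ᵥ x = 0 := by
  rw [dotProduct_mulVec, vecMul_eq_neg_mulVec hA, hv, neg_zero, zero_dotProduct]

theorem dotProduct_mulVec_self_eq_zero {A : Matrix ι ι ℂ} (hA : Aᵀ = -A) (x : ι → ℂ) :
    x ⬝ᵥ A *ᵥ x = 0 := by
  have h : x ⬝ᵥ A *ᵥ x = -(x ⬝ᵥ A *ᵥ x) := by
    conv_lhs => rw [dotProduct_mulVec, vecMul_eq_neg_mulVec hA, neg_dotProduct, dotProduct_comm]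
  exact self_eq_neg.1 h

theorem trace_vecMulVec_mul (v w : ι → ℂ) (S : Matrix ι ι ℂ) :
    (vecMulVec v w * S).trace = w ⬝ᵥ S *ᵥ v := by
  rw [vecMulVec_mul, trace_vecMulVec, dotProduct_mulVec, dotProduct_comm]

theorem add_vecMulVec_mulVec (A : Matrix ι ι ℂ) (p x : ι → ℂ) :
    (A + vecMulVec p p) *ᵥ x = A *ᵥ x + (p ⬝ᵥ x) • p := by
  simp [add_mulVec, vecMulVec_mulVec]

theorem dotProduct_add_vecMulVec_mulVec {A : Matrix ι ι ℂ} (hA : Aᵀ = -A) {v p : ι → ℂ}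
    (hv : A *ᵥ v = 0) (hp : p ⬝ᵥ v = 1) (x : ι → ℂ) :
    v ⬝ᵥ (A + vecMulVec p p) *ᵥ x = p ⬝ᵥ x := by
  rw [add_vecMulVec_mulVec, dotProduct_add, dotProduct_mulVec_eq_zero_of_skew hA hv,
    dotProduct_smul, dotProduct_comm v p, hp, zero_add, smul_eq_mul, mul_one]

variable [DecidableEq ι]

theorem exists_dotProduct_eq_one {v : ι → ℂ} (hv : v ≠ 0) : ∃ p : ι → ℂ, p ⬝ᵥ v = 1 := by
  obtain ⟨j, hj⟩ := Function.ne_iff.1 hv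
  exact ⟨Pi.single j (v j)⁻¹, by simpa using inv_mul_cancel₀ hj⟩

/-- Adding `p pᵀ`, with `p` not orthogonal to the kernel, makes a skew-symmetric matrix of corank
one invertible. -/
theorem KernelIsLine.det_add_vecMulVec_ne_zero {A : Matrix ι ι ℂ} {v p : ι → ℂ}
    (h : KernelIsLine A v) (hA : Aᵀ = -A) (hp : p ⬝ᵥ v = 1) : (A + vecMulVec p p).det ≠ 0 := by
  intro h0
  obtain ⟨x, hx, hx0⟩ := exists_mulVec_eq_zero_iff.2 h0
  have h1 : p ⬝ᵥ x = 0 := by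
    rw [← dotProduct_add_vecMulVec_mulVec hA h.mulVec_eq_zero hp, hx0, dotProduct_zero]
  rw [add_vecMulVec_mulVec, h1, zero_smul, add_zero] at hx0
  obtain ⟨c, rfl⟩ := h.exists_smul x hx0
  rw [dotProduct_smul, hp, smul_eq_mul, mul_one] at h1
  exact hx (by rw [h1, zero_smul])

theorem kernelIsLine_of_det_ne_zero {A : Matrix ι ι ℂ} {v p : ι → ℂ} {t : ℂ}
    (hv : A *ᵥ v = 0) (hp : p ⬝ᵥ v = 1) (hdet : (A + t • vecMulVec p p).det ≠ 0) :
    KernelIsLine A v where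
  ne_zero := fun h => by simp [h] at hp
  mulVec_eq_zero := hv
  exists_smul := fun x hx => by
    refine ⟨p ⬝ᵥ x, sub_eq_zero.1 <| by_contra fun hne =>
      hdet (exists_mulVec_eq_zero_iff.1 ⟨_, hne, ?_⟩)⟩
    rw [add_mulVec, smul_mulVec, vecMulVec_mulVec, mulVec_sub, mulVec_smul, hv, hx,
      dotProduct_sub, dotProduct_smul, hp]
    simp

/-- The image of a skew-symmetric matrix whose kernel is spanned by `v` is the orthogonal
complement of `v`. -/
theorem KernelIsLine.exists_mulVec_eq {A : Matrix ι ι ℂ} {v : ι → ℂ} (h : KernelIsLine A v)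
    (hA : Aᵀ = -A) {z : ι → ℂ} (hz : v ⬝ᵥ z = 0) : ∃ u, A *ᵥ u = z := by
  obtain ⟨p, hp⟩ := exists_dotProduct_eq_one h.ne_zero
  have hdet : IsUnit (A + vecMulVec p p) := by
    rw [isUnit_iff_isUnit_det, isUnit_iff_ne_zero]
    exact h.det_add_vecMulVec_ne_zero hA hp
  obtain ⟨u, hu⟩ := (mulVec_surjective_iff_isUnit.2 hdet) z
  -- Pairing with `v` shows that the rank one term vanishes on the solution `u`.
  have h1 : p ⬝ᵥ u = 0 := by
    rw [← dotProduct_add_vecMulVec_mulVec hA h.mulVec_eq_zero hp]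
    exact (congrArg _ hu).trans hz
  refine ⟨u, ?_⟩
  rw [← hu]
  simp only [add_vecMulVec_mulVec, h1, zero_smul, add_zero]

/-- Replacing a column `j` with `v j ≠ 0` by a vector outside the image makes the matrix
invertible, so that some maximal minor does not vanish. -/
theorem KernelIsLine.adjugate_ne_zero {A : Matrix ι ι ℂ} {v : ι → ℂ} (h : KernelIsLine A v)
    (hA : Aᵀ = -A) : A.adjugate ≠ 0 := by
  intro h0
  obtain ⟨j, hj⟩ := Function.ne_iff.1 h.ne_zero
  obtain ⟨p, hp⟩ := exists_dotProduct_eq_one h.ne_zero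
  have hc : (A.updateCol j p).det = 0 := by
    rw [← cramer_apply, cramer_eq_adjugate_mulVec, h0, zero_mulVec, Pi.zero_apply]
  obtain ⟨x, hx, hx0⟩ := exists_mulVec_eq_zero_iff.2 hc
  have key : A.updateCol j p *ᵥ x = A *ᵥ (x - x j • Pi.single j 1) + x j • p := by
    ext i
    simp only [mulVec_sub, mulVec_smul, mulVec_single_one, Pi.add_apply, Pi.sub_apply,
      Pi.smul_apply, smul_eq_mul, mulVec, dotProduct, col_apply]
    rw [← Finset.add_sum_erase _ _ (Finset.mem_univ j),
      ← Finset.add_sum_erase _ (fun k => A i k * x k) (Finset.mem_univ j)]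
    rw [Finset.sum_congr rfl (g := fun k => A i k * x k)]
    · simp; ring
    · intro k hk
      rw [updateCol_ne (Finset.ne_of_mem_erase hk)]
  have hxj : x j = 0 := by
    have := congrArg (v ⬝ᵥ ·) (key.symm.trans hx0)
    simpa [dotProduct_mulVec_eq_zero_of_skew hA h.mulVec_eq_zero, dotProduct_comm v p, hp]
      using this
  rw [key, hxj, zero_smul, zero_smul, sub_zero, add_zero] at hx0
  obtain ⟨c, rfl⟩ := h.exists_smul x hx0
  rcases mul_eq_zero.1 hxj with hc | hv
  · exact hx (by rw [hc, zero_smul])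
  · exact hj hv

theorem det_eq_zero_of_skew {R : Type*} [CommRing R] [NoZeroDivisors R] [CharZero R]
    (hodd : Odd (Fintype.card ι)) {A : Matrix ι ι R} (hA : Aᵀ = -A) : A.det = 0 := by
  have h : A.det = -A.det := by
    conv_lhs => rw [← det_transpose, hA, det_neg, hodd.neg_one_pow, neg_one_mul]
  exact self_eq_neg.1 h

theorem adjugate_transpose_of_skew {R : Type*} [CommRing R]
    (hodd : Odd (Fintype.card ι)) {A : Matrix ι ι R} (hA : Aᵀ = -A) :
    A.adjugateᵀ = A.adjugate := by
  obtain ⟨m, hm⟩ := hodd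
  rw [adjugate_transpose, hA, ← neg_one_smul R A, adjugate_smul, hm, Nat.add_sub_cancel,
    (even_two_mul m).neg_one_pow, one_smul]

/-- The adjugate of a skew-symmetric matrix of odd size and corank one is a nonzero multiple of
`v vᵀ`, where `v` spans the kernel. -/
theorem KernelIsLine.exists_adjugate_eq {A : Matrix ι ι ℂ} {v : ι → ℂ} (h : KernelIsLine A v)
    (hodd : Odd (Fintype.card ι)) (hA : Aᵀ = -A) :
    ∃ c : ℂ, c ≠ 0 ∧ A.adjugate = c • vecMulVec v v := by
  have hd : A * A.adjugate = 0 := by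
    rw [mul_adjugate, det_eq_zero_of_skew hodd hA, zero_smul]
  -- The columns of `adj A` lie in the kernel of `A`; symmetry then does the rest.
  have hcol : ∀ j, ∃ c : ℂ, A.adjugate.col j = c • v := fun j => h.exists_smul _ <| by
    ext i
    exact congrFun (congrFun hd i) j
  choose a ha using hcol
  have ha' : ∀ i j, A.adjugate i j = a j * v i := fun i j => congrFun (ha j) i
  obtain ⟨k, hk⟩ := Function.ne_iff.1 h.ne_zero
  have hk : v k ≠ 0 := hk
  have hsymm : ∀ i j, A.adjugate i j = A.adjugate j i := fun i j =>
    congrFun (congrFun (adjugate_transpose_of_skew hodd hA).symm i) j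
  have haj : ∀ j, a j = a k / v k * v j := fun j => by
    have := hsymm k j
    rw [ha', ha'] at this
    field_simp
    exact this
  have heq : A.adjugate = (a k / v k) • vecMulVec v v := by
    ext i j
    rw [ha', haj, Matrix.smul_apply, vecMulVec_apply, smul_eq_mul]
    ring
  refine ⟨a k / v k, fun h0 => h.adjugate_ne_zero hA ?_, heq⟩
  rw [heq, h0, zero_smul]

/-- If `tr (adj A * S) = 0`, then `S` has an isotropic vector in the kernel of `A`: that kernel is
either a line, spanned by such a vector because of the shape of `adj A`, or it has dimension at
least two. -/
theorem exists_isotropic_mem_kernel (hodd : Odd (Fintype.card ι)) {A S : Matrix ι ι ℂ}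
    (hA : Aᵀ = -A) (hS : (A.adjugate * S).trace = 0) :
    ∃ k : ι → ℂ, k ≠ 0 ∧ A *ᵥ k = 0 ∧ k ⬝ᵥ S *ᵥ k = 0 := by
  obtain ⟨a, ha, hAa⟩ := exists_mulVec_eq_zero_iff.2 (det_eq_zero_of_skew hodd hA)
  by_cases hline : ∀ x, A *ᵥ x = 0 → ∃ c : ℂ, x = c • a
  · obtain ⟨c, hc, hadj⟩ := KernelIsLine.exists_adjugate_eq ⟨ha, hAa, hline⟩ hodd hA
    rw [hadj, smul_mul, trace_smul, trace_vecMulVec_mul] at hS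
    exact ⟨a, ha, hAa, (smul_eq_zero.1 hS).resolve_left hc⟩
  · push Not at hline
    -- A quadratic form on the plane spanned by `a` and `b` has an isotropic vector.
    obtain ⟨b, hAb, hb⟩ := hline
    by_cases hSa : a ⬝ᵥ S *ᵥ a = 0
    · exact ⟨a, ha, hAa, hSa⟩
    obtain ⟨z, hz⟩ := exists_quadratic_eq_zero (b := a ⬝ᵥ S *ᵥ b + b ⬝ᵥ S *ᵥ a)
      (c := b ⬝ᵥ S *ᵥ b) hSa (by
        obtain ⟨s, hs⟩ := IsAlgClosed.exists_eq_mul_self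
          (discrim (a ⬝ᵥ S *ᵥ a) (a ⬝ᵥ S *ᵥ b + b ⬝ᵥ S *ᵥ a) (b ⬝ᵥ S *ᵥ b))
        exact ⟨s, hs⟩)
    refine ⟨z • a + b, fun h0 => hb (-z) ?_, ?_, ?_⟩
    · rw [neg_smul]; exact eq_neg_of_add_eq_zero_right h0
    · rw [mulVec_add, mulVec_smul, hAa, hAb, smul_zero, add_zero]
    · rw [← hz]
      simp only [mulVec_add, mulVec_smul, add_dotProduct, dotProduct_add, smul_dotProduct,
        dotProduct_smul, smul_eq_mul]
      ring

/-- If `A` and `B` kill `k` and the skew-symmetric matrix `B` has corank one, then `A + t B` has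
corank one for all but finitely many `t`. -/
theorem finite_setOf_not_kernelIsLine {A B : Matrix ι ι ℂ} {k : ι → ℂ} (hAk : A *ᵥ k = 0)
    (hB : Bᵀ = -B) (hk : KernelIsLine B k) : {t : ℂ | ¬ KernelIsLine (A + t • B) k}.Finite := by
  obtain ⟨p, hp⟩ := exists_dotProduct_eq_one hk.ne_zero
  -- As a polynomial in `t`, `det (A + t (B + p pᵀ))` has leading coefficient `det (B + p pᵀ)`.
  set q : Polynomial ℂ := det ((Polynomial.X : Polynomial ℂ) •
    (B + vecMulVec p p).map Polynomial.C + A.map Polynomial.C) with hq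
  have hq0 : q ≠ 0 := fun h => hk.det_add_vecMulVec_ne_zero hB hp <| by
    rw [← Polynomial.coeff_det_X_add_C_card _ A, ← hq, h, Polynomial.coeff_zero]
  have heval : ∀ t, q.eval t = (A + t • B + t • vecMulVec p p).det := fun t => by
    rw [hq, ← Polynomial.coe_evalRingHom, RingHom.map_det]
    congr 1
    ext i j
    simp
    ring
  refine (q.rootSet_finite ℂ).subset fun t ht => ?_
  rw [Polynomial.mem_rootSet, Polynomial.coe_aeval_eq_eval]
  refine ⟨hq0, by_contra fun hne => ht (kernelIsLine_of_det_ne_zero (p := p) (t := t) ?_ hp ?_)⟩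
  · rw [add_mulVec, smul_mulVec, hAk, hk.mulVec_eq_zero, smul_zero, add_zero]
  · rwa [← heval]

end LinearAlgebra

/-- The skew-symmetric tridiagonal matrix with entries `1` above and `-1` below the diagonal. -/
def skewTridiagonal (n : ℕ) : Matrix (Fin n) (Fin n) ℂ :=
  of fun i j => (if (j : ℕ) = i + 1 then 1 else 0) - (if (i : ℕ) = j + 1 then 1 else 0)

theorem skewTridiagonal_transpose (n : ℕ) : (skewTridiagonal n)ᵀ = -skewTridiagonal n := by
  ext i j
  simp [skewTridiagonal]

/-- Row `k` of `N x = 0` says `x (k + 1) = x (k - 1)`, so `x` is determined by `x 0`. -/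
theorem eq_zero_of_skewTridiagonal_mulVec {n : ℕ} {x : Fin n → ℂ}
    (hx : skewTridiagonal n *ᵥ x = 0) (h0 : ∀ h : 0 < n, x ⟨0, h⟩ = 0) : x = 0 := by
  have hrow : ∀ i : Fin n, (∑ j : Fin n, if (j : ℕ) = i + 1 then x j else 0) =
      ∑ j : Fin n, if (i : ℕ) = j + 1 then x j else 0 := fun i => by
    have := congrFun hx i
    simpa [skewTridiagonal, mulVec, dotProduct, sub_mul, Finset.sum_sub_distrib, sub_eq_zero]
      using this
  have key : ∀ k : ℕ, ∀ h : k < n, x ⟨k, h⟩ = 0 := by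
    intro k
    induction k using Nat.strong_induction_on with
    | _ k ih =>
      intro h
      rcases k with _ | k
      · exact h0 h
      · have := hrow ⟨k, by omega⟩
        rw [Finset.sum_eq_single ⟨k + 1, h⟩ (fun j _ hj => if_neg fun h' => hj (Fin.ext h'))
          (fun h' => absurd (Finset.mem_univ _) h'), if_pos rfl] at this
        rw [this]
        refine Finset.sum_eq_zero fun j _ => ?_
        split_ifs with hj
        · exact ih j (by simp at hj; omega) j.2
        · rfl
  exact funext fun i => key i i.2

theorem exists_kernelIsLine_skewTridiagonal {n : ℕ} (hodd : Odd n) :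
    ∃ v, KernelIsLine (skewTridiagonal n) v := by
  obtain ⟨v, hv, hv0⟩ := exists_mulVec_eq_zero_iff.2
    (det_eq_zero_of_skew (by simpa using hodd) (skewTridiagonal_transpose n))
  have hn : 0 < n := hodd.pos
  have h1 : v ⟨0, hn⟩ ≠ 0 := fun h => hv (eq_zero_of_skewTridiagonal_mulVec hv0 fun _ => h)
  refine ⟨v, hv, hv0, fun x hx => ⟨x ⟨0, hn⟩ / v ⟨0, hn⟩, sub_eq_zero.1 <|
    eq_zero_of_skewTridiagonal_mulVec ?_ fun _ => ?_⟩⟩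
  · rw [mulVec_sub, mulVec_smul, hx, hv0, smul_zero, sub_zero]
  · simp [div_mul_cancel₀ _ h1]

/-- In odd size, every nonzero vector spans the kernel of some skew-symmetric matrix: the linear
group acts transitively on nonzero vectors. -/
theorem exists_skew_kernelIsLine {n : ℕ} (hodd : Odd n) {v : Fin n → ℂ} (hv : v ≠ 0) :
    ∃ B : Matrix (Fin n) (Fin n) ℂ, Bᵀ = -B ∧ KernelIsLine B v := by
  obtain ⟨v₀, h₀⟩ := exists_kernelIsLine_skewTridiagonal hodd
  obtain ⟨g, hg⟩ := SeparatingDual.exists_continuousLinearEquiv_apply_eq (R := ℂ) hv h₀.ne_zero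
  set G : Matrix (Fin n) (Fin n) ℂ := LinearMap.toMatrix' (g : (Fin n → ℂ) →ₗ[ℂ] (Fin n → ℂ))
  have hG : ∀ x, G *ᵥ x = g x := fun x => by
    rw [← toLin'_apply, toLin'_toMatrix']; rfl
  have hGu : IsUnit G := by
    rw [← mulVec_injective_iff_isUnit]
    intro x y hxy
    simp only [hG] at hxy
    exact g.injective hxy
  have hGt : Function.Injective Gᵀ.mulVec :=
    mulVec_injective_iff_isUnit.2 ((isUnit_transpose G).2 hGu)
  refine ⟨Gᵀ * skewTridiagonal n * G, ?_, hv, ?_, fun x hx => ?_⟩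
  · rw [transpose_mul, transpose_mul, transpose_transpose, skewTridiagonal_transpose]
    simp [Matrix.mul_assoc]
  · rw [← mulVec_mulVec, ← mulVec_mulVec, hG, hg, h₀.mulVec_eq_zero, mulVec_zero]
  · rw [← mulVec_mulVec, ← mulVec_mulVec, hG] at hx
    obtain ⟨c, hc⟩ := h₀.exists_smul _ (hGt (hx.trans (mulVec_zero _).symm))
    refine ⟨c, g.injective ?_⟩
    rw [hc, map_smul, hg]

/-! ### The polynomial `P_Λ` as a trace -/

/-- Summing a function of `π⁻¹ l` over all permutations `π` meets every index equally often. -/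
theorem card_nsmul_sum_perm_inv {n : ℕ} {R : Type*} [AddCommMonoid R] (g : Fin n → R)
    (l : Fin n) :
    n • ∑ π : Equiv.Perm (Fin n), g (π⁻¹ l) = n.factorial • ∑ i, g i := by
  have h : ∀ l', ∑ π : Equiv.Perm (Fin n), g (π⁻¹ l') = ∑ π : Equiv.Perm (Fin n), g (π⁻¹ l) :=
    fun l' => Fintype.sum_equiv (Equiv.mulLeft (Equiv.swap l l')) _ _ fun π => by
      simp [_root_.mul_inv_rev]
  calc n • ∑ π : Equiv.Perm (Fin n), g (π⁻¹ l)
      = ∑ l', ∑ π : Equiv.Perm (Fin n), g (π⁻¹ l') := by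
        rw [Finset.sum_congr rfl fun l' _ => h l']; simp
    _ = ∑ π : Equiv.Perm (Fin n), ∑ l', g (π⁻¹ l') := Finset.sum_comm
    _ = ∑ _π : Equiv.Perm (Fin n), ∑ i, g i :=
        Finset.sum_congr rfl fun π _ => Equiv.sum_comp π⁻¹ g
    _ = n.factorial • ∑ i, g i := by simp [Fintype.card_perm]

theorem det_updateRow_eq_sum {n : ℕ} {R : Type*} [CommRing R] (A : Matrix (Fin n) (Fin n) R)
    (i : Fin n) (b : Fin n → R) : (A.updateRow i b).det = ∑ j, A.adjugate j i * b j := by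
  rw [← det_transpose, ← updateCol_transpose, ← cramer_apply, cramer_eq_adjugate_mulVec,
    ← adjugate_transpose]
  rfl

/-- `n det(A, …, A, S) = tr (adj A * S)`. -/
theorem nsmul_polarizedDet {n : ℕ} (hn : 0 < n) {R : Type} [CommRing R] [Algebra ℂ R]
    (A S : Matrix (Fin n) (Fin n) R) :
    n • polarizedDet (fun k : Fin n => if (k : ℕ) + 1 = n then S else A) =
      (A.adjugate * S).trace := by
  have hterm : ∀ π : Equiv.Perm (Fin n),
      det (of fun i j => (if ((π i : Fin n) : ℕ) + 1 = n then S else A) i j) =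
        (A.updateRow (π⁻¹ ⟨n - 1, by omega⟩) (S (π⁻¹ ⟨n - 1, by omega⟩))).det := fun π => by
    congr 1
    ext i j
    by_cases hi : i = π⁻¹ ⟨n - 1, by omega⟩
    · subst hi
      simp [Nat.sub_add_cancel hn]
    · rw [updateRow_ne hi, of_apply, if_neg]
      intro h
      exact hi (by rw [Equiv.Perm.eq_inv_iff_eq]; exact Fin.ext (by simp; omega))
  have hfac : (n.factorial : ℂ) ≠ 0 := Nat.cast_ne_zero.2 n.factorial_ne_zero
  rw [polarizedDet, Finset.sum_congr rfl fun π _ => hterm π, smul_comm,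
    card_nsmul_sum_perm_inv (fun i => (A.updateRow i (S i)).det), ← Nat.cast_smul_eq_nsmul ℂ,
    smul_smul, inv_mul_cancel₀ hfac, one_smul, trace, Finset.sum_congr rfl
      fun i _ => det_updateRow_eq_sum A i (S i), Finset.sum_comm]
  rfl

theorem natCast_mul_PLambda {n : ℕ} (hn : 0 < n) :
    (n : MvPolynomial (Fin n × Fin n) ℂ) * PLambda n =
      ((genericSkewPart n).adjugate * genericSymmPart n).trace := by
  rw [← nsmul_eq_mul, PLambda, nsmul_polarizedDet hn]

/-- The skew-symmetric part of a point of the space of matrices. -/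
noncomputable def skewPart {n : ℕ} (x : Fin n × Fin n → ℂ) : Matrix (Fin n) (Fin n) ℂ :=
  of fun i j => 2⁻¹ * (x (i, j) - x (j, i))

/-- The symmetric part of a point of the space of matrices. -/
noncomputable def symmPart {n : ℕ} (x : Fin n × Fin n → ℂ) : Matrix (Fin n) (Fin n) ℂ :=
  of fun i j => 2⁻¹ * (x (i, j) + x (j, i))

/-- The point with coordinates the entries of the matrix `M`. -/
noncomputable def ofMatrix {n : ℕ} (M : Matrix (Fin n) (Fin n) ℂ) : Fin n × Fin n → ℂ := fun p => M p.1 p.2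

theorem skewPart_transpose {n : ℕ} (x : Fin n × Fin n → ℂ) : (skewPart x)ᵀ = -skewPart x := by
  ext i j
  simp [skewPart]
  ring

theorem symmPart_transpose {n : ℕ} (x : Fin n × Fin n → ℂ) : (symmPart x)ᵀ = symmPart x := by
  ext i j
  simp [symmPart]
  ring

theorem skewPart_ofMatrix_add {n : ℕ} {A S : Matrix (Fin n) (Fin n) ℂ} (hA : Aᵀ = -A)
    (hS : Sᵀ = S) : skewPart (ofMatrix (A + S)) = A := by
  ext i j
  have h1 : A j i = -A i j := congrFun (congrFun hA i) j
  have h2 : S j i = S i j := congrFun (congrFun hS i) j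
  simp only [skewPart, ofMatrix, of_apply, Matrix.add_apply, h1, h2]
  ring

theorem symmPart_ofMatrix_add {n : ℕ} {A S : Matrix (Fin n) (Fin n) ℂ} (hA : Aᵀ = -A)
    (hS : Sᵀ = S) : symmPart (ofMatrix (A + S)) = S := by
  ext i j
  have h1 : A j i = -A i j := congrFun (congrFun hA i) j
  have h2 : S j i = S i j := congrFun (congrFun hS i) j
  simp only [symmPart, ofMatrix, of_apply, Matrix.add_apply, h1, h2]
  ring

theorem skewPart_add_smul {n : ℕ} (x y : Fin n × Fin n → ℂ) (t : ℂ) :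
    skewPart (x + t • y) = skewPart x + t • skewPart y := by
  ext i j
  simp [skewPart]
  ring

theorem symmPart_add_smul {n : ℕ} (x y : Fin n × Fin n → ℂ) (t : ℂ) :
    symmPart (x + t • y) = symmPart x + t • symmPart y := by
  ext i j
  simp [symmPart]
  ring

theorem genericSkewPart_map_eval {n : ℕ} (x : Fin n × Fin n → ℂ) :
    (genericSkewPart n).map (MvPolynomial.eval x) = skewPart x := by
  ext i j
  simp [genericSkewPart, skewPart]

theorem genericSymmPart_map_eval {n : ℕ} (x : Fin n × Fin n → ℂ) :
    (genericSymmPart n).map (MvPolynomial.eval x) = symmPart x := by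
  ext i j
  simp [genericSymmPart, symmPart, mul_add]

theorem genericSkewPart_adjugate_map_eval {n : ℕ} (x : Fin n × Fin n → ℂ) :
    (genericSkewPart n).adjugate.map (MvPolynomial.eval x) = (skewPart x).adjugate := by
  rw [← genericSkewPart_map_eval]
  exact RingHom.map_adjugate _ _

theorem genericSkewPart_transpose (n : ℕ) : (genericSkewPart n)ᵀ = -genericSkewPart n := by
  simp only [genericSkewPart, transpose_smul, transpose_sub, transpose_transpose, ← smul_neg,
    neg_sub]

theorem natCast_mul_eval_PLambda {n : ℕ} (hn : 0 < n) (x : Fin n × Fin n → ℂ) :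
    (n : ℂ) * MvPolynomial.eval x (PLambda n) = ((skewPart x).adjugate * symmPart x).trace := by
  have h := congrArg (MvPolynomial.eval x) (natCast_mul_PLambda hn)
  rw [map_mul, map_natCast] at h
  rw [h, ← genericSkewPart_adjugate_map_eval, ← genericSymmPart_map_eval, ← Matrix.map_mul]
  simp only [trace, diag_apply, map_apply, map_sum]

theorem mem_affineCone_iff {n : ℕ} (hn : 0 < n) {x : Fin n × Fin n → ℂ} :
    x ∈ affineCone (PLambda n) ↔ ((skewPart x).adjugate * symmPart x).trace = 0 := by
  rw [← natCast_mul_eval_PLambda hn, affineCone, Set.mem_ofPred_eq, mul_eq_zero,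
    or_iff_right (Nat.cast_ne_zero.2 hn.ne')]

/-! ### Directional derivatives -/

section DirDeriv

variable {σ : Type} [Fintype σ]

/-- The derivative at the point `x`, in the direction `y`, of the polynomial `f`. -/
noncomputable def dirDeriv (x y : σ → ℂ) (f : MvPolynomial σ ℂ) : ℂ :=
  ∑ i, MvPolynomial.eval x (MvPolynomial.pderiv i f) * y i

theorem dirDeriv_add (x y : σ → ℂ) (f g : MvPolynomial σ ℂ) :
    dirDeriv x y (f + g) = dirDeriv x y f + dirDeriv x y g := by
  simp [dirDeriv, add_mul, Finset.sum_add_distrib]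

theorem dirDeriv_mul (x y : σ → ℂ) (f g : MvPolynomial σ ℂ) :
    dirDeriv x y (f * g) =
      dirDeriv x y f * MvPolynomial.eval x g + MvPolynomial.eval x f * dirDeriv x y g := by
  simp only [dirDeriv, MvPolynomial.pderiv_mul, map_add, map_mul, Finset.sum_mul,
    Finset.mul_sum, ← Finset.sum_add_distrib]
  exact Finset.sum_congr rfl fun i _ => by ring

theorem dirDeriv_C (x y : σ → ℂ) (c : ℂ) : dirDeriv x y (MvPolynomial.C c) = 0 := by
  simp [dirDeriv]

theorem dirDeriv_X (x y : σ → ℂ) (i : σ) : dirDeriv x y (MvPolynomial.X i) = y i := by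
  classical
  rw [dirDeriv, Finset.sum_eq_single i]
  · simp
  · intro j _ hj
    rw [MvPolynomial.pderiv_X_of_ne hj.symm, map_zero, zero_mul]
  · exact fun h => absurd (Finset.mem_univ i) h

theorem dirDeriv_zero (x y : σ → ℂ) : dirDeriv x y 0 = 0 := by
  simpa using dirDeriv_C x y 0

theorem dirDeriv_sum (x y : σ → ℂ) {α : Type*} (s : Finset α) (f : α → MvPolynomial σ ℂ) :
    dirDeriv x y (∑ a ∈ s, f a) = ∑ a ∈ s, dirDeriv x y (f a) :=
  map_sum (AddMonoidHom.mk' (dirDeriv x y) (dirDeriv_add x y)) f s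

theorem dirDeriv_smul (x y : σ → ℂ) (c : ℂ) (f : MvPolynomial σ ℂ) :
    dirDeriv x y (c • f) = c * dirDeriv x y f := by
  rw [MvPolynomial.smul_eq_C_mul, dirDeriv_mul, dirDeriv_C, MvPolynomial.eval_C]
  ring

theorem dirDeriv_natCast_mul (x y : σ → ℂ) (m : ℕ) (f : MvPolynomial σ ℂ) :
    dirDeriv x y (m * f) = m * dirDeriv x y f := by
  rw [← map_natCast (MvPolynomial.C (R := ℂ) (σ := σ)), ← MvPolynomial.smul_eq_C_mul,
    dirDeriv_smul]

theorem dirDeriv_matrix_mul {ι : Type*} [Fintype ι] (x y : σ → ℂ)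
    (M N : Matrix ι ι (MvPolynomial σ ℂ)) :
    (M * N).map (dirDeriv x y) =
      M.map (dirDeriv x y) * N.map (MvPolynomial.eval x) +
        M.map (MvPolynomial.eval x) * N.map (dirDeriv x y) := by
  ext i j
  simp only [map_apply, mul_apply, dirDeriv_sum, dirDeriv_mul, Matrix.add_apply,
    Finset.sum_add_distrib]

theorem dirDeriv_trace {ι : Type*} [Fintype ι] (x y : σ → ℂ)
    (M : Matrix ι ι (MvPolynomial σ ℂ)) :
    dirDeriv x y M.trace = (M.map (dirDeriv x y)).trace := by
  simp [trace, dirDeriv_sum]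

/-- The chain rule for a polynomial along a differentiable curve. -/
theorem hasDerivAt_eval_comp {γ : ℂ → σ → ℂ} {y : σ → ℂ} {t : ℂ} (hγ : HasDerivAt γ y t)
    (f : MvPolynomial σ ℂ) :
    HasDerivAt (fun s => MvPolynomial.eval (γ s) f) (dirDeriv (γ t) y f) t := by
  induction f using MvPolynomial.induction_on with
  | C a => simpa [dirDeriv_C] using hasDerivAt_const t a
  | add p q hp hq =>
    simp only [dirDeriv_add, map_add]
    exact hp.add hq
  | mul_X p i hp =>
    simp only [dirDeriv_mul, dirDeriv_X, map_mul, MvPolynomial.eval_X]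
    exact hp.mul (hasDerivAt_pi.1 hγ i)

end DirDeriv

/-! ### The differential of `P_Λ` -/

theorem genericSkewPart_map_dirDeriv {n : ℕ} (x y : Fin n × Fin n → ℂ) :
    (genericSkewPart n).map (dirDeriv x y) = skewPart y := by
  ext i j
  rw [map_apply, genericSkewPart, Matrix.smul_apply, dirDeriv_smul, Matrix.sub_apply,
    sub_eq_add_neg, ← neg_one_smul ℂ, dirDeriv_add, dirDeriv_smul, transpose_apply,
    mvPolynomialX_apply, mvPolynomialX_apply, dirDeriv_X, dirDeriv_X, skewPart, of_apply]
  ring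

theorem genericSymmPart_map_dirDeriv {n : ℕ} (x y : Fin n × Fin n → ℂ) :
    (genericSymmPart n).map (dirDeriv x y) = symmPart y := by
  ext i j
  rw [map_apply, genericSymmPart, Matrix.smul_apply, dirDeriv_smul, Matrix.add_apply,
    dirDeriv_add, transpose_apply,
    mvPolynomialX_apply, mvPolynomialX_apply, dirDeriv_X, dirDeriv_X, symmPart, of_apply]

/-- If `A` is skew-symmetric with kernel spanned by `v` and `adj A = c v vᵀ`, and if `S v = A u`,
then the differential of `P_Λ` at `A + S` is a multiple of the linear form
`M ↦ vᵀ M v - 2 vᵀ A(M) u`. The derivative `N'` of `N = adj A` enters only through the relations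
`A' N + A N' = 0` and `N' A + N A' = 0`, which come from `A N = N A = 0`. -/
theorem dirDeriv_PLambda {n : ℕ} (hodd : Odd n) {x : Fin n × Fin n → ℂ} {v u : Fin n → ℂ}
    (hv : KernelIsLine (skewPart x) v) {c : ℂ}
    (hc : (skewPart x).adjugate = c • vecMulVec v v)
    (hu : symmPart x *ᵥ v = skewPart x *ᵥ u) (y : Fin n × Fin n → ℂ) :
    (n : ℂ) * dirDeriv x y (PLambda n) =
      c * (v ⬝ᵥ symmPart y *ᵥ v - 2 * (v ⬝ᵥ skewPart y *ᵥ u)) := by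
  have hcard : Odd (Fintype.card (Fin n)) := by simpa using hodd
  have hdet := det_eq_zero_of_skew hcard (genericSkewPart_transpose n)
  set A := skewPart x with hA
  set S := symmPart x with hS
  set A' := skewPart y with hA'
  set S' := symmPart y with hS'
  set N' := (genericSkewPart n).adjugate.map (dirDeriv x y) with hN'
  have hAt : Aᵀ = -A := skewPart_transpose x
  have hA't : A'ᵀ = -A' := skewPart_transpose y
  have hzero : (0 : Matrix (Fin n) (Fin n) (MvPolynomial (Fin n × Fin n) ℂ)).map
      (dirDeriv x y) = 0 := by
    ext i j
    exact dirDeriv_zero x y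
  have h1 : A' * A.adjugate + A * N' = 0 := by
    have := dirDeriv_matrix_mul x y (genericSkewPart n) (genericSkewPart n).adjugate
    rwa [mul_adjugate, hdet, zero_smul, hzero, genericSkewPart_map_dirDeriv,
      genericSkewPart_map_eval, genericSkewPart_adjugate_map_eval, eq_comm] at this
  have h2 : N' * A + A.adjugate * A' = 0 := by
    have := dirDeriv_matrix_mul x y (genericSkewPart n).adjugate (genericSkewPart n)
    rwa [adjugate_mul, hdet, zero_smul, hzero, genericSkewPart_map_dirDeriv,
      genericSkewPart_map_eval, genericSkewPart_adjugate_map_eval, eq_comm] at this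
  have hP : (n : ℂ) * dirDeriv x y (PLambda n) = (N' * S).trace + (A.adjugate * S').trace := by
    rw [← dirDeriv_natCast_mul, natCast_mul_PLambda hodd.pos, dirDeriv_trace,
      dirDeriv_matrix_mul, trace_add, genericSymmPart_map_eval, genericSymmPart_map_dirDeriv,
      genericSkewPart_adjugate_map_eval]
  have hS'tr : (A.adjugate * S').trace = c * (v ⬝ᵥ S' *ᵥ v) := by
    rw [hc, smul_mul, trace_smul, trace_vecMulVec_mul, smul_eq_mul]
  obtain ⟨p, hp⟩ := exists_dotProduct_eq_one hv.ne_zero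
  -- The columns of `S - p (A u)ᵀ` are orthogonal to `v`, so this matrix has the form `A Q`.
  have hvS : v ᵥ* S = A *ᵥ u := by
    rw [← mulVec_transpose, hS, symmPart_transpose]; exact hu
  have hcol : ∀ j, ∃ q, A *ᵥ q = (S - vecMulVec p (A *ᵥ u)).col j := fun j => by
    refine hv.exists_mulVec_eq hAt ?_
    have : (v ᵥ* (S - vecMulVec p (A *ᵥ u))) j = 0 := by
      rw [vecMul_sub, vecMul_vecMulVec, dotProduct_comm v p, hp, one_smul, hvS, sub_self,
        Pi.zero_apply]
    exact this
  choose q hq using hcol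
  set Q : Matrix (Fin n) (Fin n) ℂ := of fun i j => q j i
  have hQ : S = vecMulVec p (A *ᵥ u) + A * Q := by
    rw [← sub_eq_iff_eq_add']
    ext i j
    exact (congrFun (hq j) i).symm
  have hAv : v ⬝ᵥ A *ᵥ u = 0 := dotProduct_mulVec_eq_zero_of_skew hAt hv.mulVec_eq_zero u
  obtain ⟨l, hl⟩ : ∃ l : ℂ, Q *ᵥ v - u = l • v := by
    refine hv.exists_smul _ ?_
    have := congrArg (· *ᵥ v) hQ
    simp only [add_mulVec, vecMulVec_mulVec, dotProduct_comm _ v, hAv, MulOpposite.op_zero,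
      zero_smul, zero_add, ← mulVec_mulVec] at this
    rw [mulVec_sub, ← this, hu, sub_self]
  have hQv : Q *ᵥ v = u + l • v := by rw [← hl]; abel
  have hNA : N' * A = -(c • vecMulVec v v * A') := by
    rw [← hc]; exact eq_neg_of_add_eq_zero_left h2
  have hAN : A * N' = -(c • A' * vecMulVec v v) := by
    rw [eq_neg_of_add_eq_zero_right h1, hc, Matrix.mul_smul, smul_mul]
  have hvA'u : u ⬝ᵥ A' *ᵥ v = -(v ⬝ᵥ A' *ᵥ u) := by
    rw [dotProduct_mulVec, vecMul_eq_neg_mulVec hA't, neg_dotProduct, dotProduct_comm]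
  have ht1 : (N' * vecMulVec p (A *ᵥ u)).trace = -(c * (v ⬝ᵥ A' *ᵥ u)) := by
    rw [mul_vecMulVec, trace_vecMulVec, dotProduct_comm, ← neg_neg (A *ᵥ u),
      ← vecMul_eq_neg_mulVec hAt, neg_dotProduct, ← dotProduct_mulVec, mulVec_mulVec, hAN,
      neg_mulVec, dotProduct_neg, neg_neg, smul_mul, smul_mulVec, ← mulVec_mulVec,
      vecMulVec_mulVec, dotProduct_comm v p, hp, MulOpposite.op_one, one_smul,
      dotProduct_smul, hvA'u, smul_eq_mul, mul_neg]
  have ht2 : (N' * (A * Q)).trace = -(c * (v ⬝ᵥ A' *ᵥ u)) := by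
    rw [← Matrix.mul_assoc, hNA, neg_mul, trace_neg, smul_mul, smul_mul, trace_smul,
      Matrix.mul_assoc, trace_vecMulVec_mul, ← mulVec_mulVec, hQv, mulVec_add, mulVec_smul,
      dotProduct_add, dotProduct_smul, dotProduct_mulVec_self_eq_zero hA't, smul_zero, add_zero,
      smul_eq_mul]
  rw [hP, hS'tr, hQ, mul_add, trace_add, ht1, ht2]
  ring

/-! ### Tangent spaces of the hypersurface -/

theorem dirDeriv_single {σ : Type} [Fintype σ] [DecidableEq σ] (x : σ → ℂ) (i : σ)
    (f : MvPolynomial σ ℂ) :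
    dirDeriv x (Pi.single i 1) f = MvPolynomial.eval x (MvPolynomial.pderiv i f) := by
  simp [dirDeriv, Pi.single_apply]

theorem dirDeriv_sub_smul {σ : Type} [Fintype σ] (x y z : σ → ℂ) (c : ℂ)
    (f : MvPolynomial σ ℂ) :
    dirDeriv x (y - c • z) f = dirDeriv x y f - c * dirDeriv x z f := by
  simp only [dirDeriv, Finset.mul_sum, ← Finset.sum_sub_distrib]
  exact Finset.sum_congr rfl fun i _ => by simp; ring

theorem eval_eq_zero_of_mem_vanishingIdeal {σ : Type} {V : Set (σ → ℂ)} {f : MvPolynomial σ ℂ}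
    (hf : f ∈ MvPolynomial.vanishingIdeal ℂ V) {x : σ → ℂ} (hx : x ∈ V) :
    MvPolynomial.eval x f = 0 := by
  simpa [MvPolynomial.coe_aeval_eq_eval] using MvPolynomial.mem_vanishingIdeal_iff.1 hf x hx

theorem self_mem_vanishingIdeal {σ : Type} (P : MvPolynomial σ ℂ) :
    P ∈ MvPolynomial.vanishingIdeal ℂ (affineCone P) :=
  MvPolynomial.mem_vanishingIdeal_iff.2 fun x (hx : MvPolynomial.eval x P = 0) => by
    simpa [MvPolynomial.coe_aeval_eq_eval] using hx

/-- At a point of the hypersurface where `A` has corank one, the differential of every polynomial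
that vanishes on the hypersurface is a multiple of the differential of `P_Λ`. As `P_Λ` is linear
in the symmetric part, each curve `x + t y` can be corrected to a curve in the hypersurface by
adding a multiple of a fixed symmetric matrix. -/
theorem exists_dirDeriv_eq_mul {n : ℕ} (hodd : Odd n) {x : Fin n × Fin n → ℂ}
    (hx : x ∈ affineCone (PLambda n)) {v : Fin n → ℂ} (hv : KernelIsLine (skewPart x) v)
    {f : MvPolynomial (Fin n × Fin n) ℂ}
    (hf : f ∈ MvPolynomial.vanishingIdeal ℂ (affineCone (PLambda n))) :
    ∃ l : ℂ, ∀ y, dirDeriv x y f = l * dirDeriv x y (PLambda n) := by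
  have hcard : Odd (Fintype.card (Fin n)) := by simpa using hodd
  obtain ⟨c, hc, hadj⟩ := hv.exists_adjugate_eq hcard (skewPart_transpose x)
  obtain ⟨p, hp⟩ := exists_dotProduct_eq_one hv.ne_zero
  set S₀ : Matrix (Fin n) (Fin n) ℂ := vecMulVec p p with hS₀
  have hS₀t : S₀ᵀ = S₀ := transpose_vecMulVec _ _
  set z : Fin n × Fin n → ℂ := ofMatrix (0 + S₀) with hz
  have hzA : skewPart z = 0 := skewPart_ofMatrix_add (by simp) hS₀t
  have hzS : symmPart z = S₀ := symmPart_ofMatrix_add (by simp) hS₀t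
  -- The coefficient of `s` in `n P_Λ(M + s z)`, as a polynomial in `M`.
  set b : MvPolynomial (Fin n × Fin n) ℂ :=
    ((genericSkewPart n).adjugate * S₀.map MvPolynomial.C).trace with hb
  have hbeval : ∀ m, MvPolynomial.eval m b = ((skewPart m).adjugate * S₀).trace := fun m => by
    have h : (S₀.map MvPolynomial.C).map (MvPolynomial.eval m) = S₀ := by
      ext i j
      simp
    rw [hb, ← genericSkewPart_adjugate_map_eval, ← congrArg (fun T => trace (_ * T)) h,
      ← Matrix.map_mul]
    simp only [trace, diag_apply, map_apply, map_sum]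
  have hbx : MvPolynomial.eval x b ≠ 0 := by
    rw [hbeval, hadj, smul_mul, trace_smul, trace_vecMulVec_mul, hS₀, vecMulVec_mulVec, hp]
    simp [dotProduct_comm v p, hp, hc]
  set a : MvPolynomial (Fin n × Fin n) ℂ := n * PLambda n with ha
  have hax : MvPolynomial.eval x a = 0 := by
    rw [ha, map_mul, show MvPolynomial.eval x (PLambda n) = 0 from hx, mul_zero]
  refine ⟨n * dirDeriv x z f / MvPolynomial.eval x b, fun y => ?_⟩
  have hγ₀ : HasDerivAt (fun t : ℂ => x + t • y) y 0 := by
    simpa using ((hasDerivAt_id (0 : ℂ)).smul_const y).const_add x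
  have hda := hasDerivAt_eval_comp hγ₀ a
  have hdb := hasDerivAt_eval_comp hγ₀ b
  simp only [zero_smul, add_zero] at hda hdb
  have hquot := hda.div hdb (by simpa using hbx)
  simp only [zero_smul, add_zero, hax, zero_mul, sub_zero] at hquot
  have hγ := hγ₀.sub (hquot.smul_const z)
  have hcomp := hasDerivAt_eval_comp hγ f
  have hnear : ∀ᶠ t : ℂ in nhds 0, MvPolynomial.eval (x + t • y) b ≠ 0 :=
    hdb.continuousAt.eventually_ne (by simpa using hbx)
  have hzero : HasDerivAt (fun _ : ℂ => (0 : ℂ)) _ 0 := hcomp.congr_of_eventuallyEq <| by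
    filter_upwards [hnear] with t ht
    refine (eval_eq_zero_of_mem_vanishingIdeal hf ((mem_affineCone_iff hodd.pos).2 ?_)).symm
    simp only [Pi.sub_apply, Pi.div_apply, sub_eq_add_neg, ← neg_smul]
    rw [skewPart_add_smul, symmPart_add_smul, hzA, hzS, smul_zero, add_zero, mul_add, trace_add,
      Matrix.mul_smul, trace_smul, ← hbeval, ha, map_mul, map_natCast,
      natCast_mul_eval_PLambda hodd.pos, smul_eq_mul, neg_mul, div_mul_cancel₀ _ ht,
      add_neg_cancel]
  have h0 := hzero.unique (hasDerivAt_const _ _)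
  simp only [Pi.sub_apply, Pi.div_apply, zero_smul, add_zero, hax, zero_div, sub_zero] at h0
  rw [dirDeriv_sub_smul, sub_eq_zero] at h0
  rw [h0, ha, dirDeriv_natCast_mul]
  field_simp

theorem sum_squareAddWedge_mul {n : ℕ} (v w : Fin n → ℂ) (y : Fin n × Fin n → ℂ) :
    ∑ i, squareAddWedge v w i * y i =
      v ⬝ᵥ symmPart y *ᵥ v + 2 * (v ⬝ᵥ skewPart y *ᵥ w) := by
  have h1 : ∀ a b : Fin n → ℂ, ∑ i, ∑ j, a i * b j * y (i, j) =
      ∑ i, ∑ j, b i * a j * y (j, i) := fun a b => by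
    rw [Finset.sum_comm]
    exact Finset.sum_congr rfl fun i _ => Finset.sum_congr rfl fun j _ => by ring
  have h2 : v ⬝ᵥ symmPart y *ᵥ v =
      2⁻¹ * (∑ i, ∑ j, v i * v j * y (i, j) + ∑ i, ∑ j, v i * v j * y (j, i)) := by
    simp only [dotProduct, mulVec, symmPart, of_apply, Finset.mul_sum, ← Finset.sum_add_distrib]
    exact Finset.sum_congr rfl fun i _ => Finset.sum_congr rfl fun j _ => by ring
  have h3 : v ⬝ᵥ skewPart y *ᵥ w =
      2⁻¹ * (∑ i, ∑ j, v i * w j * y (i, j) - ∑ i, ∑ j, v i * w j * y (j, i)) := by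
    simp only [dotProduct, mulVec, skewPart, of_apply, Finset.mul_sum, ← Finset.sum_sub_distrib]
    exact Finset.sum_congr rfl fun i _ => Finset.sum_congr rfl fun j _ => by ring
  rw [h2, h3, ← h1 v v, ← h1 w v, Fintype.sum_prod_type]
  simp only [squareAddWedge, add_mul, sub_mul, Finset.sum_add_distrib, Finset.sum_sub_distrib]
  ring

theorem squareAddWedge_ne_zero {n : ℕ} {v : Fin n → ℂ} (hv : v ≠ 0) (w : Fin n → ℂ) :
    squareAddWedge v w ≠ 0 := by
  obtain ⟨j, hj⟩ := Function.ne_iff.1 hv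
  refine Function.ne_iff.2 ⟨(j, j), ?_⟩
  have : squareAddWedge v w (j, j) = v j * v j := by simp only [squareAddWedge]; ring
  rw [this]
  exact mul_ne_zero hj hj

/-- The differential of `P_Λ` at a point with `A` of corank one and `S v = A u` is a nonzero
multiple of `v² ⊕ v ∧ (-u)`. -/
theorem exists_dirDeriv_PLambda_eq {n : ℕ} (hodd : Odd n) {x : Fin n × Fin n → ℂ}
    {v u : Fin n → ℂ} (hv : KernelIsLine (skewPart x) v)
    (hu : symmPart x *ᵥ v = skewPart x *ᵥ u) :
    ∃ d : ℂ, d ≠ 0 ∧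
      ∀ y, dirDeriv x y (PLambda n) = d * ∑ i, squareAddWedge v (-u) i * y i := by
  obtain ⟨c, hc, hadj⟩ := hv.exists_adjugate_eq (by simpa using hodd) (skewPart_transpose x)
  have hn : (n : ℂ) ≠ 0 := Nat.cast_ne_zero.2 hodd.pos.ne'
  refine ⟨c / n, div_ne_zero hc hn, fun y => mul_left_cancel₀ hn ?_⟩
  rw [dirDeriv_PLambda hodd hv hadj hu, sum_squareAddWedge_mul, mulVec_neg, dotProduct_neg]
  field_simp
  ring

theorem mem_affineCone_of_mulVec_eq {n : ℕ} (hodd : Odd n) {x : Fin n × Fin n → ℂ}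
    {v u : Fin n → ℂ} (hv : KernelIsLine (skewPart x) v)
    (hu : symmPart x *ᵥ v = skewPart x *ᵥ u) : x ∈ affineCone (PLambda n) := by
  obtain ⟨c, -, hadj⟩ := hv.exists_adjugate_eq (by simpa using hodd) (skewPart_transpose x)
  rw [mem_affineCone_iff hodd.pos, hadj, smul_mul, trace_smul, trace_vecMulVec_mul, hu,
    dotProduct_mulVec_eq_zero_of_skew (skewPart_transpose x) hv.mulVec_eq_zero, smul_zero]

/-- The condition `vᵀ S v = 0` says that `S v` lies in the image of `A`. -/
theorem exists_mulVec_eq_of_mem_affineCone {n : ℕ} (hodd : Odd n) {x : Fin n × Fin n → ℂ}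
    {v : Fin n → ℂ} (hv : KernelIsLine (skewPart x) v) (hx : x ∈ affineCone (PLambda n)) :
    ∃ u, symmPart x *ᵥ v = skewPart x *ᵥ u := by
  obtain ⟨c, hc, hadj⟩ := hv.exists_adjugate_eq (by simpa using hodd) (skewPart_transpose x)
  rw [mem_affineCone_iff hodd.pos, hadj, smul_mul, trace_smul, trace_vecMulVec_mul,
    smul_eq_zero, or_iff_right hc] at hx
  obtain ⟨u, hu⟩ := hv.exists_mulVec_eq (skewPart_transpose x) hx
  exact ⟨u, hu.symm⟩

theorem coneTangentSpace_eq {n : ℕ} (hodd : Odd n) {x : Fin n × Fin n → ℂ}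
    {v u : Fin n → ℂ} (hv : KernelIsLine (skewPart x) v)
    (hu : symmPart x *ᵥ v = skewPart x *ᵥ u) :
    coneTangentSpace (PLambda n) x = {y | ∑ i, squareAddWedge v (-u) i * y i = 0} := by
  obtain ⟨d, hd, hdP⟩ := exists_dirDeriv_PLambda_eq hodd hv hu
  ext y
  refine ⟨fun hy => ?_, fun hy f hf => ?_⟩
  · have h : dirDeriv x y (PLambda n) = 0 := hy _ (self_mem_vanishingIdeal _)
    rw [hdP] at h
    exact (mul_eq_zero.1 h).resolve_left hd
  · obtain ⟨l, hl⟩ := exists_dirDeriv_eq_mul hodd (mem_affineCone_of_mulVec_eq hodd hv hu) hv hf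
    have h := hl y
    rw [hdP, show ∑ i, squareAddWedge v (-u) i * y i = 0 from hy, mul_zero, mul_zero] at h
    exact h

/-- Every point `[v² ⊕ v ∧ w]` is the tangent hyperplane at some point of the hypersurface. -/
theorem squareWedgePoints_subset_tangentHyperplanes {n : ℕ} (hodd : Odd n) (hn : 3 ≤ n) :
    squareWedgePoints n ⊆ tangentHyperplanes (PLambda n) := by
  rintro ξ ⟨v, w, h, rfl⟩
  have hv : v ≠ 0 := by
    rintro rfl
    exact h (funext fun p => by simp [squareAddWedge])
  obtain ⟨B, hB, hBv⟩ := exists_skew_kernelIsLine hodd hv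
  obtain ⟨p, hp⟩ := exists_dotProduct_eq_one hv
  -- A symmetric matrix with `S v = - B w`.
  set S : Matrix (Fin n) (Fin n) ℂ :=
    vecMulVec (B *ᵥ (-w)) p + vecMulVec p (B *ᵥ (-w)) with hS
  have hSt : Sᵀ = S := by
    rw [hS, transpose_add, transpose_vecMulVec, transpose_vecMulVec, add_comm]
  have hSv : S *ᵥ v = B *ᵥ (-w) := by
    rw [hS, add_mulVec, vecMulVec_mulVec, vecMulVec_mulVec, hp, dotProduct_comm _ v,
      dotProduct_mulVec_eq_zero_of_skew hB hBv.mulVec_eq_zero]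
    simp
  set x := ofMatrix (B + S) with hx
  have hxA : skewPart x = B := skewPart_ofMatrix_add hB hSt
  have hxS : symmPart x = S := symmPart_ofMatrix_add hB hSt
  rw [← hxA] at hBv
  rw [← hxA, ← hxS] at hSv
  have : Nontrivial (Fin n) := Fin.nontrivial_iff_two_le.2 (by omega)
  refine ⟨x, fun h0 => ?_, mem_affineCone_of_mulVec_eq hodd hBv hSv, ?_⟩
  · have hA0 : skewPart x = 0 := by
      ext i j
      simp [skewPart, h0]
    exact hBv.adjugate_ne_zero (skewPart_transpose x) (by rw [hA0, adjugate_zero])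
  · obtain ⟨a, ha⟩ := Projectivization.exists_smul_eq_mk_rep ℂ _ h
    rw [coneTangentSpace_eq hodd hBv hSv, ← ha, neg_neg]
    ext y
    simp [Units.smul_def, mul_assoc, ← Finset.mul_sum]

/-! ### Limits of tangent hyperplanes -/

theorem eval_smul_of_isHomogeneous {σ : Type} {g : MvPolynomial σ ℂ} {d : ℕ}
    (hg : g.IsHomogeneous d) (c : ℂ) (x : σ → ℂ) :
    MvPolynomial.eval (c • x) g = c ^ d * MvPolynomial.eval x g := by
  rw [MvPolynomial.eval_eq, MvPolynomial.eval_eq, Finset.mul_sum]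
  refine Finset.sum_congr rfl fun m hm => ?_
  have hdeg : ∑ i ∈ m.support, m i = d := by
    have := hg (MvPolynomial.mem_support_iff.1 hm)
    simpa [Finsupp.weight_apply, Finsupp.sum] using this
  simp only [Pi.smul_apply, smul_eq_mul, mul_pow, Finset.prod_mul_distrib,
    Finset.prod_pow_eq_pow_sum, hdeg]
  ring

/-- A homogeneous polynomial that vanishes on the points `[v² ⊕ v ∧ w]` vanishes at the
differential of every polynomial `f` in the ideal of the hypersurface, at every point of the
hypersurface. If `A` has corank one, that differential is a multiple of some `v² ⊕ v ∧ w`. In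
general, the point is a limit of such points along a line in the hypersurface: take an isotropic
vector `k` of `S` in the kernel of `A` and move `A` in a direction whose kernel is spanned by
`k`. -/
theorem eval_gradient_eq_zero {n : ℕ} (hodd : Odd n)
    {g : MvPolynomial (Fin n × Fin n) ℂ} {d : ℕ} (hg : g.IsHomogeneous d)
    (hg0 : ∀ ξ ∈ squareWedgePoints n, MvPolynomial.eval ξ.rep g = 0)
    {f : MvPolynomial (Fin n × Fin n) ℂ}
    (hf : f ∈ MvPolynomial.vanishingIdeal ℂ (affineCone (PLambda n)))
    {x : Fin n × Fin n → ℂ} (hx : x ∈ affineCone (PLambda n)) :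
    MvPolynomial.eval (fun i => MvPolynomial.eval x (MvPolynomial.pderiv i f)) g = 0 := by
  have hreg : ∀ {m : Fin n × Fin n → ℂ} {v : Fin n → ℂ}, m ∈ affineCone (PLambda n) →
      KernelIsLine (skewPart m) v →
      MvPolynomial.eval (fun i => MvPolynomial.eval m (MvPolynomial.pderiv i f)) g = 0 := by
    intro m v hm hv
    obtain ⟨u, hu⟩ := exists_mulVec_eq_of_mem_affineCone hodd hv hm
    obtain ⟨e, -, he⟩ := exists_dirDeriv_PLambda_eq hodd hv hu
    obtain ⟨l, hl⟩ := exists_dirDeriv_eq_mul hodd hm hv hf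
    have hgrad : (fun i => MvPolynomial.eval m (MvPolynomial.pderiv i f)) =
        (l * e) • squareAddWedge v (-u) := funext fun i => by
      rw [← dirDeriv_single, hl, he]
      simp [Pi.single_apply, mul_assoc]
    have hne := squareAddWedge_ne_zero hv.ne_zero (-u)
    have h0 := hg0 _ ⟨v, -u, hne, rfl⟩
    obtain ⟨a, ha⟩ := Projectivization.exists_smul_eq_mk_rep ℂ _ hne
    rw [← ha, Units.smul_def, eval_smul_of_isHomogeneous hg, mul_eq_zero,
      or_iff_right (pow_ne_zero _ a.ne_zero)] at h0
    rw [hgrad, eval_smul_of_isHomogeneous hg, h0, mul_zero]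
  obtain ⟨k, hk, hAk, hSk⟩ := exists_isotropic_mem_kernel (by simpa using hodd)
    (skewPart_transpose x) ((mem_affineCone_iff hodd.pos).1 hx)
  obtain ⟨B, hB, hBk⟩ := exists_skew_kernelIsLine hodd hk
  set y := ofMatrix (B + 0) with hy
  have hyA : skewPart y = B := skewPart_ofMatrix_add hB (by simp)
  have hyS : symmPart y = 0 := symmPart_ofMatrix_add hB (by simp)
  have hfin := finite_setOf_not_kernelIsLine hAk hB hBk
  have hcont : Continuous fun t : ℂ => MvPolynomial.eval
      (fun i => MvPolynomial.eval (x + t • y) (MvPolynomial.pderiv i f)) g :=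
    (MvPolynomial.continuous_eval g).comp <| continuous_pi fun i =>
      (MvPolynomial.continuous_eval _).comp (by fun_prop)
  have hext := Continuous.ext_on (hfin.countable.dense_compl ℂ) hcont continuous_const
    (g := fun _ => (0 : ℂ)) <| by
      intro t ht
      have hline : KernelIsLine (skewPart (x + t • y)) k := by
        rw [skewPart_add_smul, hyA]
        exact not_not.1 ht
      refine hreg ?_ hline
      obtain ⟨u, hu⟩ := hline.exists_mulVec_eq (skewPart_transpose _) hSk
      refine mem_affineCone_of_mulVec_eq hodd hline (u := u) ?_
      rw [hu, symmPart_add_smul, hyS, smul_zero, add_zero]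
  simpa using congrFun hext 0

theorem tangentHyperplanes_subset_zariskiClosure {n : ℕ} (hodd : Odd n) :
    tangentHyperplanes (PLambda n) ⊆ zariskiClosure (squareWedgePoints n) := by
  rintro ξ ⟨x, -, hx, hξ⟩ Y ⟨⟨F, hF, rfl⟩, hY⟩ g hgF
  obtain ⟨d, hg⟩ := hF g hgF
  obtain ⟨j, hj⟩ := Function.ne_iff.1 ξ.rep_nonzero
  have hj : ξ.rep j ≠ 0 := hj
  -- A tangent space that is a hyperplane is cut out by the differential of a single polynomial.
  obtain ⟨f, hf, hfx⟩ : ∃ f ∈ MvPolynomial.vanishingIdeal ℂ (affineCone (PLambda n)),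
      (fun i => MvPolynomial.eval x (MvPolynomial.pderiv i f)) ≠ 0 := by
    by_contra! h
    have : (Pi.single j 1 : Fin n × Fin n → ℂ) ∈ {y | ∑ i, ξ.rep i * y i = 0} := by
      rw [hξ]
      intro f hf
      exact Finset.sum_eq_zero fun i _ => by rw [congrFun (h f hf) i, Pi.zero_apply, zero_mul]
    exact hj (by simpa [Pi.single_apply] using this)
  set η : Fin n × Fin n → ℂ := fun i => MvPolynomial.eval x (MvPolynomial.pderiv i f) with hη
  have hprop : η = (η j / ξ.rep j) • ξ.rep := funext fun i => by
    have hmem : (ξ.rep j • Pi.single i 1 - ξ.rep i • Pi.single j 1 : Fin n × Fin n → ℂ) ∈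
        {y | ∑ i, ξ.rep i * y i = 0} := by
      simp [Pi.single_apply, mul_sub, Finset.sum_sub_distrib]
      ring
    rw [hξ] at hmem
    have h := hmem f hf
    simp [Pi.single_apply, mul_sub, Finset.sum_sub_distrib] at h
    rw [Pi.smul_apply, smul_eq_mul, div_mul_eq_mul_div, eq_div_iff hj]
    exact sub_eq_zero.1 h
  have h0 := eval_gradient_eq_zero hodd hg (fun ζ hζ => hY hζ g hgF) hf hx
  rw [← hη, hprop, eval_smul_of_isHomogeneous hg, mul_eq_zero] at h0
  refine h0.resolve_left (pow_ne_zero _ fun h => hfx ?_)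
  rw [hprop, h, zero_smul]

/-! ### Equality of the two varieties -/

theorem subset_zariskiClosure {σ : Type} (X : Set (ℙ ℂ (σ → ℂ))) : X ⊆ zariskiClosure X :=
  Set.subset_sInter fun _ hY => hY.2

theorem zariskiClosure_subset_of_subset {σ : Type} {X Y : Set (ℙ ℂ (σ → ℂ))}
    (h : X ⊆ zariskiClosure Y) : zariskiClosure X ⊆ zariskiClosure Y :=
  Set.subset_sInter fun _ hZ =>
    Set.sInter_subset_of_mem ⟨hZ.1, h.trans (Set.sInter_subset_of_mem hZ)⟩

theorem dualVariety_PLambda_eq {n : ℕ} (hodd : Odd n) (hn : 3 ≤ n) :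
    dualVariety (PLambda n) = zariskiClosure (squareWedgePoints n) :=
  (zariskiClosure_subset_of_subset (tangentHyperplanes_subset_zariskiClosure hodd)).antisymm <|
    zariskiClosure_subset_of_subset <|
      (squareWedgePoints_subset_tangentHyperplanes hodd hn).trans (subset_zariskiClosure _)

theorem isRegularMap_id {σ : Type} (X : Set (ℙ ℂ (σ → ℂ))) :
    IsRegularMap (Equiv.refl X : X → X) := fun x =>
  ⟨1, MvPolynomial.X, fun j => MvPolynomial.isHomogeneous_X ℂ j, by
    simpa using x.1.rep_nonzero, fun y hy => by simp⟩

theorem AreIsomorphic.refl {σ : Type} (X : Set (ℙ ℂ (σ → ℂ))) : AreIsomorphic X X :=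
  ⟨Equiv.refl X, isRegularMap_id X, isRegularMap_id X⟩

end DualLambda

theorem mainTheorem8 (n : ℕ) (hodd : Odd n) (hn : 3 ≤ n) :
    DualLambda.AreIsomorphic
      (DualLambda.dualVariety (DualLambda.PLambda n))
      (DualLambda.zariskiClosure (DualLambda.squareWedgePoints n)) := by
  rw [DualLambda.dualVariety_PLambda_eq hodd hn]
  exact DualLambda.AreIsomorphic.refl _
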